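/- Let $S_n$ be the symmetric group on $\{1,\dots,n\}$ and let $\mathbb F_r$ be the free group on $x_1,\dots,x_r$. Every $w\in S_n*\mathbb F_r$ can be written uniquely in reduced form $$w=c_0x_{\iota(1)}^{\varepsilon(1)}c_1\cdots c_{l-1}x_{\iota(l)}^{\varepsilon(l)}c_l,\qquad c_j\in S_n,\ \varepsilon(j)\in\{\pm1\},$$ where reduced means that $c_j\neq 1$ for every critical index $j$, that is, for every $j\in\{1,\dots,l-1\}$ with $\iota(j)=\iota(j+1)$ and $\varepsilon(j)=-\varepsilon(j+1)$. The number $l$ is called the length of $w$, and the $c_j$ with $j$ critical are called the critical constants of $w$. The element $w$ is called regular if it is not conjugate in $S_n*\mathbb F_r$ to an element of $S_n$ and each critical constant of (the reduced form of) $w^2$ is a permutation without fixed points. For $g_1,\dots,g_r\in S_n$ let $w(g_1,\dots,g_r)\in S_n$ be the image of $w$ under the homomorphism $S_n*\mathbb F_r\to S_n$ that is the identity on $S_n$ and maps $x_i$ to $g_i$. Let $\mu_w^{S_n}$ be the push-forward of the uniform probability measure on $S_n^r$ under the map $w\colon S_n^r\to S_n$, and let $\mu_{\rm unif}^{S_n}$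 be the uniform probability measure on $S_n$. For a probability measure $\mu$ on $S_n$ put $\Sigma(\mu)(A)=\frac1{n!}\sum_{\sigma\in S_n}\mu(\sigma^{-1}A\sigma)$. Let $d(\sigma,\tau)=\frac1n|\{i:\sigma(i)\ne\tau(i)\}|$ be the normalized Hamming metric on $S_n$ and let $$d(\mu,\nu)=\min_\gamma\int d(\sigma,\tau)\,d\gamma(\sigma,\tau)$$ be the associated Kantorovich–Rubinstein distance of probability measures on $S_n$, where $\gamma$ runs over the probability measures on $S_n\times S_n$ with marginals $\mu$ and $\nu$. **Theorem.** Let $\varepsilon>0$. There exists a constant $c_\varepsilon>0$, depending only on $\varepsilon$, such that for all $n\ge1$, all $r\ge 0$ and every regular $w\in S_n*\mathbb F_r$ of length $l\ge1$, $$d\bigl(\Sigma(\mu_w^{S_n}),\mu_{\rm unif}^{S_n}\bigr)\le c_\varepsilon\, l^2\, n^{-1/3+\varepsilon}.$$ -/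

import Mathlib

/-- A factor `x_i ^ ε · c` of a word with constants: a variable `x_i`, a sign `ε = ±1`,
and the constant `c` that follows it. -/
structure WordLetter (G : Type*) (r : ℕ) where
  var : Fin r
  sign : ℤˣ
  const : G

/-- A (not necessarily reduced) expression
`c₀ x_{i(1)}^{ε(1)} c₁ x_{i(2)}^{ε(2)} c₂ ⋯ x_{i(l)}^{ε(l)} c_l`
in the group `G` and the variables `x_1, …, x_r`. It is stored as the constant `c₀` and the list
of the factors `x_{i(j)}^{ε(j)} c_j`, for `j = 1, …, l`. -/
structure ConstWord (G : Type*) (r : ℕ) where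
  head : G
  letters : List (WordLetter G r)

namespace ConstWord

variable {G : Type*} {r : ℕ}

/-- The number `l` of variables `x_{i(j)}^{ε(j)}` that occur. -/
def length (W : ConstWord G r) : ℕ := W.letters.length

/-- The element of the free product `G * F_r` that the expression represents. -/
def toCoprod [Group G] (W : ConstWord G r) : Monoid.Coprod G (FreeGroup (Fin r)) :=
  Monoid.Coprod.inl W.head *
    (W.letters.map fun a =>
      Monoid.Coprod.inr (FreeGroup.of a.var) ^ (a.sign : ℤ) * Monoid.Coprod.inl a.const).prod

/-- `c` is a critical constant of the expression: `c = c_j` for some `1 ≤ j ≤ l - 1` with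
`i(j) = i(j+1)` and `ε(j) = -ε(j+1)`. That is, the two letters `x_i^ε c` and `x_i^{-ε} d`
stand next to each other somewhere. -/
def IsCriticalConst (W : ConstWord G r) (c : G) : Prop :=
  ∃ (i : Fin r) (ε : ℤˣ) (d : G), [⟨i, ε, c⟩, ⟨i, -ε, d⟩] <:+: W.letters

/-- The expression is reduced: no critical constant is trivial. These are the normal forms of
the elements of `G * F_r`. (If `G` has trivial centre, as `S_n` has for `n ≠ 2`,
nontrivial means the same as non-central. In `S_2` this notion admits more expressions.) -/
def IsReduced [Group G] (W : ConstWord G r) : Prop :=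
  ∀ c, W.IsCriticalConst c → c ≠ 1

end ConstWord

/-- An element `w` of `S_n * F_r` is regular if it is not conjugate to an element of `S_n` and
each critical constant of (the reduced form of) `w²` is a permutation without fixed points. -/
def IsRegularWord {n r : ℕ}
    (w : Monoid.Coprod (Equiv.Perm (Fin n)) (FreeGroup (Fin r))) : Prop :=
  (¬ ∃ g : Equiv.Perm (Fin n), IsConj (Monoid.Coprod.inl g) w) ∧
    ∀ V : ConstWord (Equiv.Perm (Fin n)) r, V.IsReduced → V.toCoprod = w ^ 2 →
      ∀ c, V.IsCriticalConst c → ∀ i, c i ≠ i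

/-- The value `w(g_1, …, g_r)`: the image of `w` under the homomorphism `G * F_r → G` that fixes
`G` and sends `x_i` to `g_i`. -/
def wordValue {G : Type*} [Group G] {r : ℕ} (w : Monoid.Coprod G (FreeGroup (Fin r)))
    (g : Fin r → G) : G :=
  Monoid.Coprod.lift (MonoidHom.id G) (FreeGroup.lift g) w

/-- The distribution of word values: the push-forward of the uniform distribution on `S_n^r`
under `w`. -/
noncomputable def wordDistribution {n r : ℕ}
    (w : Monoid.Coprod (Equiv.Perm (Fin n)) (FreeGroup (Fin r))) : PMF (Equiv.Perm (Fin n)) :=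
  (PMF.uniformOfFintype (Fin r → Equiv.Perm (Fin n))).map (wordValue w)

/-- The conjugation-invariant measure `Σ(μ)`: conjugate a `μ`-random permutation by
an independent, uniformly random permutation. -/
noncomputable def conjSymmetrize {n : ℕ} (μ : PMF (Equiv.Perm (Fin n))) :
    PMF (Equiv.Perm (Fin n)) :=
  (PMF.uniformOfFintype (Equiv.Perm (Fin n))).bind fun σ => μ.map fun τ => σ * τ * σ⁻¹

/-- `Σ(μ)(A) = (1 / n!) ∑_σ μ(A^σ)`. -/
theorem conjSymmetrize_toOuterMeasure_apply {n : ℕ} (μ : PMF (Equiv.Perm (Fin n)))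
    (A : Set (Equiv.Perm (Fin n))) :
    (conjSymmetrize μ).toOuterMeasure A =
      (n.factorial : ENNReal)⁻¹ *
        ∑ σ : Equiv.Perm (Fin n), μ.toOuterMeasure {τ | σ * τ * σ⁻¹ ∈ A} := by
  rw [conjSymmetrize, PMF.toOuterMeasure_bind_apply, tsum_fintype, Finset.mul_sum]
  refine Finset.sum_congr rfl fun σ _ => ?_
  rw [PMF.toOuterMeasure_map_apply, PMF.uniformOfFintype_apply, Fintype.card_perm,
    Fintype.card_fin]
  rfl

/-- The normalized Hamming distance `(1/n) |{i | σ i ≠ τ i}|` on `S_n`. -/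
noncomputable def normalizedHamming {n : ℕ} (σ τ : Equiv.Perm (Fin n)) : ℝ :=
  (hammingDist (σ : Fin n → Fin n) (τ : Fin n → Fin n) : ℝ) / n

/-- The Kantorovich–Rubinstein distance on the probability measures on `S_n` for the normalized
Hamming metric: the infimum of the transport costs over all couplings `γ` of `μ` and `ν`. -/
noncomputable def kantorovichRubinstein {n : ℕ} (μ ν : PMF (Equiv.Perm (Fin n))) : ℝ :=
  sInf {t : ℝ | ∃ γ : PMF (Equiv.Perm (Fin n) × Equiv.Perm (Fin n)),
    γ.map Prod.fst = μ ∧ γ.map Prod.snd = ν ∧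
      t = ∑ p : Equiv.Perm (Fin n) × Equiv.Perm (Fin n),
        (γ p).toReal * normalizedHamming p.1 p.2}

/-! Two permutations with few cycles are close up to conjugation. Multiplying by a transposition
across two cycles merges them and changes at most two values, so a permutation with `c` cycles lies
within Hamming distance `2c` of a full cycle, and all full cycles are conjugate. Since `Σ` averages
over conjugation, the conjugator may be chosen freely for each pair
(`kantorovichRubinstein_conjSymmetrize_le`). It remains to bound the expected number of cycles of a
word value and of a uniform permutation.

Cycles longer than `K` number at most `n / K`, so the task is to count points of period at most `K`.
By regularity, `w` is conjugate to a cyclic word of length at most `l` whose cyclic critical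
constants have no fixed points. Follow a point along `T = K l` letters of this word, revealing the
random permutations one value at a time. A fixed-point-free critical constant keeps the path from
going straight back along the edge just revealed, so at each step only `O(T)` of the possible images
close the path or lead to a query already answered. The path therefore returns with probability at
most `4 T² / n` (`card_hits_self_le`).

Hence there are at most `4 K² l² + n / K` cycles on average. The uniform permutation is the case of
the word `x₁`. Taking `K` near `n^(1/3)` balances the two terms. -/

/-! ### Letters, words and cyclic reduction -/

namespace WordLetter

variable {G : Type*} {r : ℕ}

/-- The element `x_i ^ ε · c` of `G * F_r`. -/
def toCoprod [Group G] (a : WordLetter G r) : Monoid.Coprod G (FreeGroup (Fin r)) :=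
  Monoid.Coprod.inr (FreeGroup.of a.var) ^ (a.sign : ℤ) * Monoid.Coprod.inl a.const

/-- If the constant between the consecutive letters `a` and `b` is critical, it satisfies `P`. -/
def CriticalImp (P : G → Prop) (a b : WordLetter G r) : Prop :=
  a.var = b.var → b.sign = -a.sign → P a.const

/-- The letter `x_i ^ ε · (c * k)`. -/
def mulConst [Group G] (a : WordLetter G r) (k : G) : WordLetter G r :=
  { a with const := a.const * k }

theorem toCoprod_mulConst [Group G] (a : WordLetter G r) (k : G) :
    (a.mulConst k).toCoprod = a.toCoprod * Monoid.Coprod.inl k := by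
  simp [toCoprod, mulConst, mul_assoc]

end WordLetter

open WordLetter

namespace ConstWord

variable {G : Type*} {r : ℕ}

/-- The element of `G * F_r` represented by a list of letters. -/
def lettersVal [Group G] (L : List (WordLetter G r)) : Monoid.Coprod G (FreeGroup (Fin r)) :=
  (L.map WordLetter.toCoprod).prod

section lettersVal

variable [Group G]

@[simp] theorem lettersVal_nil : lettersVal ([] : List (WordLetter G r)) = 1 := rfl

@[simp] theorem lettersVal_cons (a : WordLetter G r) (L : List (WordLetter G r)) :
    lettersVal (a :: L) = a.toCoprod * lettersVal L := by simp [lettersVal]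

@[simp] theorem lettersVal_append (L M : List (WordLetter G r)) :
    lettersVal (L ++ M) = lettersVal L * lettersVal M := by simp [lettersVal]

theorem toCoprod_eq (W : ConstWord G r) :
    W.toCoprod = Monoid.Coprod.inl W.head * lettersVal W.letters := rfl

end lettersVal

/-- A condition on adjacent letters passes easily to infixes, concatenations and reversals. -/
theorem forall_isCriticalConst_iff (W : ConstWord G r) (P : G → Prop) :
    (∀ c, W.IsCriticalConst c → P c) ↔ W.letters.IsChain (CriticalImp P) := by
  rw [List.isChain_iff_forall_rel_of_append_cons_cons]
  constructor
  · rintro h ⟨i, e, c⟩ ⟨j, e', d⟩ l₁ l₂ hl hv hs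
    simp only at hv hs
    subst hv hs
    exact h c ⟨i, e, d, l₁, l₂, by simp [hl]⟩
  · rintro h c ⟨i, e, d, l₁, l₂, hl⟩
    exact @h ⟨i, e, c⟩ ⟨i, -e, d⟩ l₁ l₂ (by simp [← hl]) rfl rfl

/-- Cyclic reduction: peel off first and last letters that cancel cyclically. -/
theorem exists_cyclic_core [Group G] (a : G) (M : List (WordLetter G r)) :
    ∀ (A B : List (WordLetter G r)) (u : Monoid.Coprod G (FreeGroup (Fin r))) (k : G),
      Monoid.Coprod.inl a * lettersVal A = u * Monoid.Coprod.inl k → lettersVal B * u = 1 →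
      (∀ g, ¬ IsConj (Monoid.Coprod.inl g) (Monoid.Coprod.inl a * lettersVal (A ++ M ++ B))) →
      ∃ (A' M' : List (WordLetter G r)) (t : WordLetter G r) (B' : List (WordLetter G r))
        (u' : Monoid.Coprod G (FreeGroup (Fin r))) (k' : G),
        A ++ M ++ B = A' ++ (M' ++ [t]) ++ B' ∧
        Monoid.Coprod.inl a * lettersVal A' = u' * Monoid.Coprod.inl k' ∧
        lettersVal B' * u' = 1 ∧
        ∀ y ∈ (M' ++ [t]).head?, CriticalImp (· ≠ 1) (t.mulConst k') y := by
  induction M using List.bidirectionalRec with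
  -- Throughout, the whole word equals `u * (inl k * M) * u⁻¹`. If `M` is used up, the word is
  -- conjugate to the constant `k`, which is excluded.
  | nil =>
    intro A B u k hA hB hw
    refine absurd ?_ (hw k)
    rw [isConj_iff]
    refine ⟨u, ?_⟩
    rw [List.append_nil, lettersVal_append, ← mul_assoc, hA, eq_inv_of_mul_eq_one_left hB]
  | singleton t =>
    intro A B u k hA hB _
    refine ⟨A, [], t, B, u, k, by simp, hA, hB, ?_⟩
    rintro y hy - hs
    obtain rfl : t = y := by simpa using hy
    rcases Int.units_eq_one_or t.sign with h | h <;> simp [mulConst, h] at hs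
  | cons_append y M t ih =>
    intro A B u k hA hB hw
    by_cases h : CriticalImp (· ≠ 1) (t.mulConst k) y
    · exact ⟨A, y :: M, t, B, u, k, by simp, hA, hB, by simpa using h⟩
    · simp only [CriticalImp, mulConst, ne_eq, not_forall, not_not] at h
      obtain ⟨hv, hs, hc⟩ := h
      -- The outer letters cancel cyclically: `y` moves into the conjugator and `y.const` becomes
      -- the new `k`.
      have hA' : Monoid.Coprod.inl a * lettersVal (A ++ [y]) =
          u * Monoid.Coprod.inl k * Monoid.Coprod.inr (FreeGroup.of y.var) ^ (y.sign : ℤ) *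
            Monoid.Coprod.inl y.const := by
        rw [lettersVal_append, ← mul_assoc, hA]
        simp [WordLetter.toCoprod, mul_assoc]
      have hB' : lettersVal ([t] ++ B) * (u * Monoid.Coprod.inl k *
          Monoid.Coprod.inr (FreeGroup.of y.var) ^ (y.sign : ℤ)) = 1 := by
        have hk : (Monoid.Coprod.inl t.const : Monoid.Coprod G (FreeGroup (Fin r))) *
            Monoid.Coprod.inl k = 1 := by rw [← map_mul, hc, map_one]
        rw [lettersVal_append, eq_inv_of_mul_eq_one_left hB]
        simp only [lettersVal_cons, lettersVal_nil, mul_one,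
          WordLetter.toCoprod, hs, hv, Units.val_neg, zpow_neg]
        generalize (Monoid.Coprod.inr (FreeGroup.of y.var) :
          Monoid.Coprod G (FreeGroup (Fin r))) = x
        calc _ = x ^ (t.sign : ℤ) * (Monoid.Coprod.inl t.const * Monoid.Coprod.inl k) *
              (x ^ (t.sign : ℤ))⁻¹ := by group
          _ = 1 := by rw [hk]; group
      have hL : A ++ (y :: (M ++ [t])) ++ B = A ++ [y] ++ M ++ ([t] ++ B) := by simp
      rw [hL] at hw ⊢
      exact ih _ _ _ _ hA' hB' hw

end ConstWord

open ConstWord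

/-- A regular word is conjugate to a cyclically reduced word without constant head, all of whose
cyclic critical constants are free of fixed points. -/
theorem IsRegularWord.exists_cyclic {n r : ℕ}
    {w : Monoid.Coprod (Equiv.Perm (Fin n)) (FreeGroup (Fin r))} (hw : IsRegularWord w)
    {W : ConstWord (Equiv.Perm (Fin n)) r} (hW : W.IsReduced) (hWw : W.toCoprod = w) :
    ∃ N : List (WordLetter (Equiv.Perm (Fin n)) r), N ≠ [] ∧ N.length ≤ W.length ∧
      IsConj (lettersVal N) w ∧
      (N ++ N).IsChain (CriticalImp fun c => ∀ i, c i ≠ i) := by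
  obtain ⟨a, L⟩ := W
  subst hWw
  rw [toCoprod_eq] at hw ⊢
  obtain ⟨A, M, t, B, u, k, hL, hA, hB, ht⟩ := exists_cyclic_core a L [] [] 1 a (by simp)
    (by simp) (fun g hg => hw.1 ⟨g, by simpa using hg⟩)
  simp only [List.nil_append, List.append_nil] at hL
  subst hL
  have hred := (forall_isCriticalConst_iff _ _).1 hW
  have hB' : lettersVal B = u⁻¹ := eq_inv_of_mul_eq_one_left hB
  -- With `w = u k M t u⁻¹`, this is a reduced expression for `w²`. Its middle part shows every
  -- cyclic junction of `M t k`, so regularity of `w` applies to all of them.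
  have hsq := hw.2 ⟨a, A ++ (M ++ [t.mulConst k]) ++ (M ++ [t]) ++ B⟩ ?_ ?_
  · rw [forall_isCriticalConst_iff] at hsq
    refine ⟨M ++ [t.mulConst k], by simp, ?_, ?_, ?_⟩
    · simp [ConstWord.length]
      omega
    · rw [isConj_iff]
      refine ⟨u * Monoid.Coprod.inl k, ?_⟩
      simp only [lettersVal_append, lettersVal_cons, lettersVal_nil, mul_one, ← mul_assoc, hA,
        hB', toCoprod_mulConst]
      group
    · replace hsq : ((M ++ [t.mulConst k]) ++ (M ++ [t])).IsChain _ :=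
        hsq.infix ⟨A, B, by simp⟩
      rw [List.isChain_append] at hsq ⊢
      refine ⟨hsq.1, hsq.1, ?_⟩
      cases M with
      | nil => simp [CriticalImp, mulConst]
      | cons y M => simpa using hsq.2.2
  · refine (forall_isCriticalConst_iff _ _).2 ?_
    cases M with
    | nil =>
      simp only [List.nil_append, List.append_assoc, List.isChain_append, List.isChain_cons,
        List.isChain_nil] at hred ht ⊢
      simp_all [CriticalImp, mulConst]
    | cons y M =>
      simp only [List.append_assoc, List.isChain_append, List.isChain_cons] at hred ht ⊢
      simp_all [CriticalImp, mulConst]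
  · rw [toCoprod_eq]
    simp only [lettersVal_append, lettersVal_cons, lettersVal_nil, mul_one, ← mul_assoc, hA,
        hB', toCoprod_mulConst, pow_two]
    group

/-! ### Numbers of cycles and Hamming distance -/

namespace Equiv.Perm

variable {α : Type*} [Fintype α]

/-- The number of cycles of a permutation, fixed points included. -/
noncomputable def numCycles (f : Perm α) : ℕ := Nat.card (Quotient (SameCycle.setoid f))

/-- Give weight `1` to points of period at most `K` and a further `1 / K` to every point. Each cycle
then has total weight at least `1`: it contains a point of short period or has at least `K` points.
-/
theorem numCycles_le (f : Perm α) {K : ℕ} (hK : 0 < K) :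
    (numCycles f : ℝ) ≤
      Nat.card {p : α // ∃ k, 0 < k ∧ k ≤ K ∧ (f ^ k) p = p} + (Fintype.card α : ℝ) / K := by
  classical
  let _ := Fintype.ofFinite (Quotient (SameCycle.setoid f))
  let bad : α → Prop := fun p => ∃ k, 0 < k ∧ k ≤ K ∧ (f ^ k) p = p
  have hKR : (0 : ℝ) < K := by exact_mod_cast hK
  have key : ∀ q : Quotient (SameCycle.setoid f),
      (1 : ℝ) ≤ ∑ p with Quotient.mk (SameCycle.setoid f) p = q,
        ((if bad p then 1 else 0) + 1 / (K : ℝ)) := by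
    intro q
    induction q using Quotient.inductionOn with
    | h p =>
    by_cases hp : bad p
    · refine le_trans ?_ (Finset.single_le_sum (a := p) (fun x _ => ?_) (by simp))
      · simp only [hp, if_true]
        have : 0 < 1 / (K : ℝ) := by positivity
        linarith
      · split_ifs <;> positivity
    · have hcard : K ≤ (Finset.univ.filter
          fun x => Quotient.mk (SameCycle.setoid f) x = Quotient.mk _ p).card := by
        rw [← Finset.card_range K]
        refine Finset.card_le_card_of_injOn (fun k => (f ^ k) p) ?_ ?_
        · intro k _
          simp only [Finset.coe_filter, Finset.mem_univ, true_and, Set.mem_ofPred_eq]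
          exact Quotient.sound (show SameCycle f _ _ by simp [SameCycle.refl])
        · have : ∀ i j, i < j → j < K → (f ^ i) p ≠ (f ^ j) p := by
            intro i j hij hj h
            refine hp ⟨j - i, by omega, by omega, ?_⟩
            apply (f ^ i).injective
            rw [← mul_apply, ← pow_add, h]
            congr 2
            omega
          intro i hi j hj hij
          simp only [Finset.coe_range, Set.mem_Iio] at hi hj
          rcases lt_trichotomy i j with h | h | h
          · exact absurd hij (this i j h hj)
          · exact h
          · exact absurd hij.symm (this j i h hi)
      calc (1 : ℝ) = K * (1 / K) := by field_simp
        _ ≤ (Finset.univ.filter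
          fun x => Quotient.mk (SameCycle.setoid f) x = Quotient.mk _ p).card * (1 / (K : ℝ)) := by
            gcongr
        _ = ∑ x with Quotient.mk (SameCycle.setoid f) x = Quotient.mk _ p, (1 / (K : ℝ)) := by
            simp
        _ ≤ _ := by
            refine Finset.sum_le_sum fun x _ => ?_
            split_ifs <;> simp
  calc (numCycles f : ℝ) = ∑ q : Quotient (SameCycle.setoid f), (1 : ℝ) := by
        simp [numCycles, Nat.card_eq_fintype_card]
    _ ≤ ∑ q : Quotient (SameCycle.setoid f),
        ∑ p with Quotient.mk (SameCycle.setoid f) p = q,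
          ((if bad p then 1 else 0) + 1 / (K : ℝ)) := Finset.sum_le_sum fun q _ => key q
    _ = ∑ p : α, ((if bad p then 1 else 0) + 1 / (K : ℝ)) :=
        Finset.sum_fiberwise _ _ _
    _ = _ := by
        rw [Finset.sum_add_distrib, Nat.card_eq_fintype_card, Fintype.card_subtype]
        simp [bad, div_eq_mul_inv]

variable [DecidableEq α]

/-- Multiplying by a transposition of points in different cycles merges their cycles. -/
theorem numCycles_mul_swap_lt {f : Perm α} {x y : α} (hxy : ¬ SameCycle f x y) :
    numCycles (f * swap x y) < numCycles f := by
  classical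
  let _ := Fintype.ofFinite (Quotient (SameCycle.setoid f))
  let _ := Fintype.ofFinite (Quotient (SameCycle.setoid (f * swap x y)))
  set h := f * swap x y with hh
  have merge : ∀ x y : α, ¬ SameCycle f x y → SameCycle (f * swap x y) x y := by
    intro x y hxy
    have hx : (f * swap x y) x = f y := by simp
    -- From `x`, the new permutation jumps to `f y` and then follows the `f`-orbit of `y`, which
    -- avoids `x`, until it arrives at `y`.
    have step : ∀ k : ℕ, SameCycle (f * swap x y) x ((f ^ (k + 1)) y) ∨
        SameCycle (f * swap x y) x y := by
      intro k
      induction k with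
      | zero => left; rw [zero_add, pow_one, ← hx]; exact sameCycle_apply_right.2 (SameCycle.refl _ _)
      | succ k ih =>
        rcases ih with ih | ih
        · by_cases hk : (f ^ (k + 1)) y = y
          · right; rwa [hk] at ih
          · left
            have hkx : (f ^ (k + 1)) y ≠ x := by
              intro e
              apply hxy
              rw [← e]
              simp [SameCycle.refl]
            have : (f ^ (k + 1 + 1)) y = (f * swap x y) ((f ^ (k + 1)) y) := by
              rw [mul_apply, swap_apply_of_ne_of_ne hkx hk, pow_succ' f (k + 1), mul_apply]
            rw [this]
            exact sameCycle_apply_right.2 ih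
        · exact Or.inr ih
    rcases step (orderOf f - 1) with h1 | h1
    · rw [Nat.sub_add_cancel (orderOf_pos f), pow_orderOf_eq_one] at h1
      simpa using h1
    · exact h1
  have mxy : SameCycle h x y := merge x y hxy
  have base : ∀ a, SameCycle h a (f a) := by
    intro a
    by_cases hax : a = x
    · subst hax
      have : h y = f a := by simp [hh]
      rw [← this]
      simpa using mxy
    · by_cases hay : a = y
      · subst hay
        have : h x = f a := by simp [hh]
        rw [← this]
        simpa using mxy.symm
      · have : h a = f a := by rw [hh, mul_apply, swap_apply_of_ne_of_ne hax hay]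
        rw [← this]
        exact sameCycle_apply_right.2 (SameCycle.refl _ _)
  have ext : ∀ a b, SameCycle f a b → SameCycle h a b := by
    intro a b hab
    obtain ⟨i, -, rfl⟩ := hab.exists_pow_eq'
    clear hab
    induction i with
    | zero => exact SameCycle.refl _ _
    | succ i ih =>
      rw [pow_succ', mul_apply]
      exact ih.trans (base _)
  unfold numCycles
  rw [Nat.card_eq_fintype_card, Nat.card_eq_fintype_card]
  -- Old cycles lie inside new ones, and those of `x` and `y` have become one.
  refine Fintype.card_lt_of_surjective_not_injective
    (Quotient.map' (s₁ := SameCycle.setoid f) (s₂ := SameCycle.setoid h) id ext) ?_ ?_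
  · intro q
    induction q using Quotient.inductionOn with
    | h a => exact ⟨Quotient.mk _ a, rfl⟩
  · intro hinj
    have := @hinj (Quotient.mk _ x) (Quotient.mk _ y) (Quotient.sound mxy)
    exact hxy (Quotient.exact this)

theorem hammingDist_mul_swap_le (f : Perm α) (x y : α) :
    hammingDist (f : α → α) (f * swap x y : Perm α) ≤ 2 := by
  refine le_trans (Finset.card_le_card (t := {x, y}) ?_) Finset.card_le_two
  intro a ha
  by_contra hc
  simp only [Finset.mem_insert, Finset.mem_singleton, not_or] at hc
  exact (Finset.mem_filter.1 ha).2 (by rw [mul_apply, swap_apply_of_ne_of_ne hc.1 hc.2])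

theorem exists_transitive_hammingDist_le (f : Perm α) :
    ∃ z : Perm α, (∀ x y, SameCycle z x y) ∧
      hammingDist (f : α → α) z ≤ 2 * numCycles f := by
  induction hn : numCycles f using Nat.strong_induction_on generalizing f with
  | _ n ih =>
  subst hn
  by_cases h : ∀ x y, SameCycle f x y
  · exact ⟨f, h, by simp⟩
  · push Not at h
    obtain ⟨x, y, hxy⟩ := h
    have hlt := numCycles_mul_swap_lt hxy
    obtain ⟨z, hz, hd⟩ := ih _ hlt _ rfl
    refine ⟨z, hz, ?_⟩
    have := hammingDist_triangle (f : α → α) (f * swap x y : Perm α) z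
    have := hammingDist_mul_swap_le f x y
    omega

/-- Both are cycles of full support. A one-point type is separate because the identity is not an
`IsCycle`. -/
theorem isConj_of_forall_sameCycle {y z : Perm α} (hy : ∀ a b, SameCycle y a b)
    (hz : ∀ a b, SameCycle z a b) : IsConj y z := by
  rcases subsingleton_or_nontrivial α with h | h
  · rw [Subsingleton.elim y z]
  · have aux : ∀ f : Perm α, (∀ a b, SameCycle f a b) →
        f.IsCycle ∧ f.support = Finset.univ := by
      intro f hf
      have hne : ∀ a, f a ≠ a := by
        intro a ha
        obtain ⟨b, hb⟩ := exists_ne a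
        obtain ⟨i, hi⟩ := hf a b
        rw [zpow_apply_eq_self_of_apply_eq_self ha] at hi
        exact hb hi.symm
      obtain ⟨a, -⟩ := exists_pair_ne α
      exact ⟨⟨a, hne a, fun b _ => hf a b⟩, by ext b; simp [hne b]⟩
    refine (aux y hy).1.isConj (aux z hz).1 ?_
    rw [(aux y hy).2, (aux z hz).2]

theorem hammingDist_conj (u f h : Perm α) :
    hammingDist (u * f * u⁻¹ : Perm α) (u * h * u⁻¹ : Perm α) =
      hammingDist (f : α → α) h := by
  unfold hammingDist
  refine Finset.card_bij (fun a _ => u⁻¹ a) ?_ ?_ ?_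
  · intro a ha
    simpa using ha
  · intro a _ b _ hab
    exact u⁻¹.injective hab
  · intro b hb
    exact ⟨u b, by simpa using hb, by simp⟩

/-- Up to conjugation, two permutations differ by at most twice their numbers of cycles. -/
theorem exists_conj_hammingDist_le {f₀ f : Perm α} (hf : IsConj f₀ f) (h : Perm α) :
    ∃ t : Perm α, hammingDist (f : α → α) (t * h * t⁻¹ : Perm α) ≤
      2 * numCycles f₀ + 2 * numCycles h := by
  obtain ⟨u, rfl⟩ := isConj_iff.1 hf
  obtain ⟨y, hy, hfy⟩ := exists_transitive_hammingDist_le f₀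
  obtain ⟨z, hz, hhz⟩ := exists_transitive_hammingDist_le h
  obtain ⟨t, rfl⟩ := isConj_iff.1 (isConj_of_forall_sameCycle hz hy)
  refine ⟨u * t, ?_⟩
  have e : u * t * h * (u * t)⁻¹ = u * (t * h * t⁻¹) * u⁻¹ := by group
  rw [e, hammingDist_conj]
  have h1 := hammingDist_triangle (f₀ : α → α) (t * z * t⁻¹ : Perm α) (t * h * t⁻¹ : Perm α)
  rw [hammingDist_conj, hammingDist_comm z] at h1
  omega

end Equiv.Perm

/-! ### Lazy revelation of random permutations -/

namespace Equiv.Perm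

section LazyRevelation

open Classical

variable {α : Type*} {r : ℕ}

/-- The tuple `g` respects the edges `E`, where the edge `(i, e, a, b)` means `g_i ^ e` sends `a`
to `b`. -/
def SatisfiesEdges (g : Fin r → Perm α) (E : Finset (Fin r × ℤˣ × α × α)) : Prop :=
  ∀ x ∈ E, (g x.1 ^ (x.2.1 : ℤ)) x.2.2.1 = x.2.2.2

/-- The edges `E` determine the image of `a` under `g_i ^ e`. -/
def IsRevealed (E : Finset (Fin r × ℤˣ × α × α)) (i : Fin r) (e : ℤˣ) (a : α) : Prop :=
  ∃ b, (i, e, a, b) ∈ E ∨ (i, -e, b, a) ∈ E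

/-- Multiply `g_i ^ e` on the left by the transposition of `b` and `z`. -/
noncomputable def swapImages (g : Fin r → Perm α) (i : Fin r) (e : ℤˣ) (b z : α) :
    Fin r → Perm α :=
  Function.update g i ((swap b z * g i ^ (e : ℤ)) ^ (e : ℤ))

theorem swapImages_zpow (g : Fin r → Perm α) (i : Fin r) (e : ℤˣ) (b z : α) :
    swapImages g i e b z i ^ (e : ℤ) = swap b z * g i ^ (e : ℤ) := by
  rw [swapImages, Function.update_self, ← zpow_mul, ← Units.val_mul, Int.units_mul_self]
  simp

theorem swapImages_swapImages (g : Fin r → Perm α) (i : Fin r) (e : ℤˣ) (b z : α) :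
    swapImages (swapImages g i e b z) i e b z = g := by
  rw [swapImages, swapImages_zpow, ← mul_assoc, swap_mul_self, one_mul, ← zpow_mul,
    ← Units.val_mul, Int.units_mul_self]
  simp [swapImages]

/-- The transposition only moves `b` and `z`, and neither is the image of a revealed edge. -/
theorem SatisfiesEdges.swapImages {g : Fin r → Perm α} {E : Finset (Fin r × ℤˣ × α × α)}
    (hg : SatisfiesEdges g E) {i : Fin r} {e : ℤˣ} {b z : α}
    (hb : ¬ IsRevealed E i (-e) b) (hz : ¬ IsRevealed E i (-e) z) :
    SatisfiesEdges (swapImages g i e b z) E := by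
  rintro ⟨j, e', a', b'⟩ hx
  have hgx := hg _ hx
  simp only at hgx ⊢
  by_cases hj : j = i
  · subst hj
    by_cases he : e' = e
    · subst he
      rw [swapImages_zpow, mul_apply, hgx, swap_apply_of_ne_of_ne]
      · rintro rfl
        exact hb ⟨a', Or.inr (by simpa using hx)⟩
      · rintro rfl
        exact hz ⟨a', Or.inr (by simpa using hx)⟩
    · obtain rfl : e' = -e := by
        rcases Int.units_eq_one_or e with rfl | rfl <;>
          rcases Int.units_eq_one_or e' with rfl | rfl <;> simp_all
      rw [Units.val_neg, zpow_neg] at hgx ⊢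
      rw [swapImages_zpow, mul_inv_rev, mul_apply, swap_inv, swap_apply_of_ne_of_ne]
      · exact hgx
      · rintro rfl
        exact hb ⟨b', Or.inl hx⟩
      · rintro rfl
        exact hz ⟨b', Or.inl hx⟩
  · rwa [Perm.swapImages, Function.update_of_ne hj]

theorem satisfiesEdges_insert (g : Fin r → Perm α) (E : Finset (Fin r × ℤˣ × α × α))
    (i : Fin r) (e : ℤˣ) (a b : α) :
    SatisfiesEdges g (insert (i, e, a, b) E) ↔
      SatisfiesEdges g E ∧ (g i ^ (e : ℤ)) a = b := by
  simp [SatisfiesEdges, and_comm]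

variable [Fintype α]

theorem card_isRevealed_le (E : Finset (Fin r × ℤˣ × α × α)) (i : Fin r) (e : ℤˣ) :
    (Finset.univ.filter fun a => IsRevealed E i e a).card ≤ E.card := by
  refine le_trans (Finset.card_le_card (t := E.image
    fun x => if x.2.1 = e then x.2.2.1 else x.2.2.2) ?_) Finset.card_image_le
  intro a ha
  obtain ⟨b, hb | hb⟩ := (Finset.mem_filter.1 ha).2
  · exact Finset.mem_image.2 ⟨_, hb, by simp⟩
  · refine Finset.mem_image.2 ⟨_, hb, if_neg ?_⟩
    rcases Int.units_eq_one_or e with rfl | rfl <;> simp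

/-- Conditionally on `E`, an unrevealed image takes each value with probability at most `1 / (n -
|E|)`. Exchanging `b` with any unused value `z` keeps `E` satisfied, and the resulting map from
pairs `(z, g)` is injective, as `z` is the new image of `a`. -/
theorem card_satisfiesEdges_and_eq_le (E : Finset (Fin r × ℤˣ × α × α)) {i : Fin r} {e : ℤˣ}
    {a : α} (ha : ¬ IsRevealed E i e a) (b : α) :
    (Fintype.card α - E.card) *
      (Finset.univ.filter fun g : Fin r → Perm α =>
        SatisfiesEdges g E ∧ (g i ^ (e : ℤ)) a = b).card ≤
      (Finset.univ.filter fun g : Fin r → Perm α => SatisfiesEdges g E).card := by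
  by_cases hb : IsRevealed E i (-e) b
  · rw [Finset.filter_false_of_mem]
    · simp
    · rintro g - ⟨hg, hgb⟩
      obtain ⟨c, hc | hc⟩ := hb
      · have := hg _ hc
        simp only [Units.val_neg, zpow_neg, inv_eq_iff_eq] at this
        have h2 : c = a := (g i ^ (e : ℤ)).injective (by rw [← this, hgb])
        subst h2
        exact ha ⟨b, Or.inr hc⟩
      · rw [neg_neg] at hc
        have := hg _ hc
        have h2 : c = a := (g i ^ (e : ℤ)).injective (by rw [hgb]; exact this)
        subst h2
        exact ha ⟨b, Or.inl hc⟩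
  · have hU : Fintype.card α - E.card ≤
        (Finset.univ.filter fun z => ¬ IsRevealed E i (-e) z).card := by
      have h1 := Finset.card_filter_add_card_filter_not (s := (Finset.univ : Finset α))
        (fun z => IsRevealed E i (-e) z)
      have h2 := card_isRevealed_le E i (-e)
      rw [Finset.card_univ] at h1
      omega
    refine (Nat.mul_le_mul_right _ hU).trans ?_
    rw [← Finset.card_product]
    refine Finset.card_le_card_of_injOn (fun x => swapImages x.2 i e b x.1) ?_ ?_
    · rintro ⟨z, g⟩ h
      simp only [Finset.coe_product, Finset.coe_filter, Finset.mem_univ, true_and, Set.mem_prod,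
        Set.mem_ofPred_eq] at h ⊢
      exact h.2.1.swapImages hb h.1
    · rintro ⟨z, g⟩ h ⟨z', g'⟩ h' heq
      simp only [Finset.coe_product, Finset.coe_filter, Finset.mem_univ, true_and, Set.mem_prod,
        Set.mem_ofPred_eq] at h h' heq
      have e1 := swapImages_zpow g i e b z
      have e2 := swapImages_zpow g' i e b z'
      rw [heq, e2] at e1
      have e3 := DFunLike.congr_fun e1 a
      simp only [mul_apply, h.2.2, h'.2.2, swap_apply_left] at e3
      subst e3
      rw [← swapImages_swapImages g i e b z', heq, swapImages_swapImages]

/-- The path that starts at `q` and applies the letters of a list one after the other visits `p`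
after its start. -/
def Hits (g : Fin r → Perm α) (p : α) : List (WordLetter (Perm α) r) → α → Prop
  | [], _ => False
  | s :: S, q => (g s.var ^ (s.sign : ℤ)) (s.const q) = p ∨
      Hits g p S ((g s.var ^ (s.sign : ℤ)) (s.const q))

/-- There are few images `b` after which the path closes up or its next query is revealed. -/
theorem card_bad_images_le (p : α) (s : WordLetter (Perm α) r) (S : List (WordLetter (Perm α) r))
    (q : α) (E : Finset (Fin r × ℤˣ × α × α))
    (hS : (s :: S).IsChain fun a b => CriticalImp (fun c : Perm α => ∀ x, c x ≠ x) b a) :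
    (Finset.univ.filter fun b => b = p ∨ ∃ s' ∈ S.head?,
      IsRevealed (insert (s.var, s.sign, s.const q, b) E) s'.var s'.sign (s'.const b)).card ≤
      E.card + 2 := by
  cases S with
  | nil =>
    simp only [List.head?_nil, Option.not_mem_none, false_and, exists_false, or_false]
    rw [Finset.filter_eq' Finset.univ p]
    simp
  | cons s' S =>
    have hs : CriticalImp (fun c : Perm α => ∀ x, c x ≠ x) s' s :=
      (List.isChain_cons_cons.1 hS).1
    refine le_trans (Finset.card_le_card (t := (Finset.univ.filter
      fun b => IsRevealed E s'.var s'.sign (s'.const b)) ∪ {p, s'.const⁻¹ (s.const q)}) ?_)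
      ((Finset.card_union_le _ _).trans (Nat.add_le_add ?_ Finset.card_le_two))
    · intro b hb
      simp only [List.head?_cons, Option.mem_def, Option.some.injEq, exists_eq_left',
        Finset.mem_filter, Finset.mem_univ, true_and] at hb
      simp only [Finset.mem_union, Finset.mem_filter, Finset.mem_univ, true_and,
        Finset.mem_insert, Finset.mem_singleton]
      rcases hb with hb | ⟨c, hc | hc⟩
      · exact Or.inr (Or.inl hb)
      · rcases Finset.mem_insert.1 hc with h | h
        · simp only [Prod.mk.injEq] at h
          exact Or.inr (Or.inr (by rw [← h.2.2.1]; simp))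
        · exact Or.inl ⟨c, Or.inl h⟩
      · rcases Finset.mem_insert.1 hc with h | h
        · simp only [Prod.mk.injEq] at h
          -- Going back along the new edge would need a fixed point `s'.const b = b` of a critical
          -- constant.
          exact absurd h.2.2.2 (hs h.1 h.2.1.symm b)
        · exact Or.inl ⟨c, Or.inr h⟩
    · refine le_trans ?_ (card_isRevealed_le E s'.var s'.sign)
      refine Finset.card_le_card_of_injOn s'.const ?_ s'.const.injective.injOn
      intro b hb
      simpa using hb

/-- A union bound over steps: condition on the image `b` of the current query. At most `M + 1`
images are bad, each of probability at most `1 / (n - M)`; otherwise the next query is fresh and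
induction applies with one more edge. The budget `M` bounds edges plus remaining letters, so the
rate is the same at every step. -/
theorem card_hits_le (p : α) {M : ℕ} (hM : M < Fintype.card α)
    (S : List (WordLetter (Perm α) r)) :
    ∀ (q : α) (E : Finset (Fin r × ℤˣ × α × α)), E.card + S.length ≤ M →
      S.IsChain (fun a b => CriticalImp (fun c : Perm α => ∀ x, c x ≠ x) b a) →
      (∀ s ∈ S.head?, ¬ IsRevealed E s.var s.sign (s.const q)) →
      ((Finset.univ.filter fun g : Fin r → Perm α =>
        SatisfiesEdges g E ∧ Hits g p S q).card : ℝ) ≤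
        S.length * ((M + 1) / (Fintype.card α - M)) *
          (Finset.univ.filter fun g : Fin r → Perm α => SatisfiesEdges g E).card := by
  have hM' : (0 : ℝ) < Fintype.card α - M := by
    rw [sub_pos]
    exact_mod_cast hM
  induction S with
  | nil =>
    intro q E _ _ _
    simp [Hits]
  | cons s S ih =>
    intro q E hE hS hfresh
    set N := (Finset.univ.filter fun g : Fin r → Perm α => SatisfiesEdges g E).card with hN
    set κ : ℝ := (M + 1) / (Fintype.card α - M) with hκ
    have hκ0 : 0 ≤ κ := by positivity
    have hfresh' : ¬ IsRevealed E s.var s.sign (s.const q) := hfresh s (by simp)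
    let F : α → Finset (Fin r → Perm α) := fun b => Finset.univ.filter fun g =>
      SatisfiesEdges g E ∧ (g s.var ^ (s.sign : ℤ)) (s.const q) = b
    let Bad : Finset α := Finset.univ.filter fun b => b = p ∨ ∃ s' ∈ S.head?,
      IsRevealed (insert (s.var, s.sign, s.const q, b) E) s'.var s'.sign (s'.const b)
    have hFsum : ∑ b, ((F b).card : ℝ) = N := by
      rw [hN, Finset.card_eq_sum_card_fiberwise (t := Finset.univ)
        (f := fun g : Fin r → Perm α => (g s.var ^ (s.sign : ℤ)) (s.const q))
        (fun _ _ => Finset.mem_coe.2 (Finset.mem_univ _))]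
      push_cast
      refine Finset.sum_congr rfl fun b _ => ?_
      rw [Finset.filter_filter]
    have hF : ∀ b, ((F b).card : ℝ) ≤ N / (Fintype.card α - M) := by
      intro b
      rw [le_div_iff₀ hM', mul_comm]
      have h1 := card_satisfiesEdges_and_eq_le E hfresh' b
      have h2 : (Fintype.card α - M) * (F b).card ≤ N :=
        le_trans (Nat.mul_le_mul_right _ (by simp at hE; omega)) h1
      rw [← Nat.cast_sub hM.le]
      exact_mod_cast h2
    have hterm : ∀ b, (((Finset.univ.filter fun g : Fin r → Perm α =>
        SatisfiesEdges g E ∧ Hits g p (s :: S) q).filter fun g =>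
          (g s.var ^ (s.sign : ℤ)) (s.const q) = b).card : ℝ) ≤
        (if b ∈ Bad then (N : ℝ) / (Fintype.card α - M) else 0) +
          S.length * κ * (F b).card := by
      intro b
      have hsub : ((Finset.univ.filter fun g : Fin r → Perm α =>
          SatisfiesEdges g E ∧ Hits g p (s :: S) q).filter fun g =>
          (g s.var ^ (s.sign : ℤ)) (s.const q) = b) ⊆ F b := by
        intro g hg
        simp only [Finset.mem_filter, Finset.mem_univ, true_and, F] at hg ⊢
        exact ⟨hg.1.1, hg.2⟩
      by_cases hb : b ∈ Bad
      · rw [if_pos hb]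
        have h1 : (((Finset.univ.filter fun g : Fin r → Perm α =>
          SatisfiesEdges g E ∧ Hits g p (s :: S) q).filter fun g =>
          (g s.var ^ (s.sign : ℤ)) (s.const q) = b).card : ℝ) ≤ (F b).card := by
          exact_mod_cast Finset.card_le_card hsub
        have h2 : 0 ≤ S.length * κ * (F b).card := by positivity
        linarith [hF b]
      · rw [if_neg hb, zero_add]
        simp only [Bad, Finset.mem_filter, Finset.mem_univ, true_and, not_or, not_exists,
          not_and] at hb
        have h1 := ih b (insert (s.var, s.sign, s.const q, b) E) ?_ hS.tail hb.2
        · refine le_trans ?_ (h1.trans (le_of_eq ?_))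
          · refine Nat.cast_le.2 (Finset.card_le_card fun g hg => ?_)
            simp only [Finset.mem_filter, Finset.mem_univ, true_and] at hg ⊢
            obtain ⟨⟨hgE, hgH⟩, hgb⟩ := hg
            rw [Hits, hgb] at hgH
            exact ⟨(satisfiesEdges_insert _ _ _ _ _ _).2 ⟨hgE, hgb⟩, hgH.resolve_left hb.1⟩
          · simp only [satisfiesEdges_insert, F]
        · have := Finset.card_insert_le (s.var, s.sign, s.const q, b) E
          simp at hE
          omega
    rw [Finset.card_eq_sum_card_fiberwise (t := Finset.univ)
        (f := fun g : Fin r → Perm α => (g s.var ^ (s.sign : ℤ)) (s.const q))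
        (fun _ _ => Finset.mem_coe.2 (Finset.mem_univ _))]
    push_cast
    refine (Finset.sum_le_sum fun b _ => hterm b).trans ?_
    rw [Finset.sum_add_distrib, ← Finset.mul_sum, hFsum, Finset.sum_ite_mem, Finset.univ_inter,
      Finset.sum_const, nsmul_eq_mul]
    have hBad : (Bad.card : ℝ) ≤ M + 1 := by
      have h1 := card_bad_images_le p s S q E hS
      have h2 : Bad.card ≤ M + 1 := h1.trans (by simp at hE; omega)
      exact_mod_cast h2
    have h3 : (Bad.card : ℝ) * (N / (Fintype.card α - M)) ≤ κ * N := by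
      rw [hκ, div_mul_eq_mul_div, ← mul_div_assoc]
      gcongr
    simp only [List.length_cons]
    push_cast
    linarith

/-- The probability that the path of `p` closes up within `T` steps is at most `4 T² / n`. -/
theorem card_hits_self_le (p : α) (S : List (WordLetter (Perm α) r)) (hS0 : S ≠ [])
    (hS : S.IsChain (fun a b => CriticalImp (fun c : Perm α => ∀ x, c x ≠ x) b a)) :
    ((Finset.univ.filter fun g : Fin r → Perm α => Hits g p S p).card : ℝ) ≤
      4 * (S.length : ℝ) ^ 2 / Fintype.card α * Fintype.card (Fin r → Perm α) := by
  have hn : (0 : ℝ) < Fintype.card α := by exact_mod_cast Fintype.card_pos_iff.2 ⟨p⟩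
  have hT : (1 : ℝ) ≤ S.length := by exact_mod_cast List.length_pos_iff.2 hS0
  -- If `2T ≤ n`, then `T (T + 1) / (n - T) ≤ 4 T² / n`; otherwise the claimed bound exceeds `1`.
  rcases le_or_gt (2 * S.length) (Fintype.card α) with h | h
  · have hlt : S.length < Fintype.card α := by
      have := List.length_pos_iff.2 hS0
      omega
    have h1 := card_hits_le p hlt S p ∅ (by simp) hS (by simp [IsRevealed])
    have h0 : ∀ g : Fin r → Perm α, SatisfiesEdges g ∅ := fun g => by simp [SatisfiesEdges]
    simp only [h0, true_and, Finset.filter_true, Finset.card_univ] at h1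
    refine h1.trans ?_
    gcongr
    have hR : 2 * (S.length : ℝ) ≤ Fintype.card α := by exact_mod_cast h
    rw [← mul_div_assoc, div_le_div_iff₀ (by linarith) hn]
    nlinarith [mul_nonneg (sub_nonneg.2 hT) hn.le, mul_nonneg (sub_nonneg.2 hR)
      (sq_nonneg (S.length : ℝ)), mul_nonneg (mul_nonneg (sub_nonneg.2 hT) hn.le)
      (zero_le_one.trans hT)]
  · have h1 : (1 : ℝ) ≤ 4 * (S.length : ℝ) ^ 2 / Fintype.card α := by
      rw [one_le_div hn]
      have hR : (Fintype.card α : ℝ) ≤ 2 * (S.length : ℝ) := by exact_mod_cast h.le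
      nlinarith
    calc ((Finset.univ.filter fun g : Fin r → Perm α => Hits g p S p).card : ℝ)
        ≤ 1 * Fintype.card (Fin r → Perm α) := by
          rw [one_mul]
          exact_mod_cast Finset.card_le_univ _
      _ ≤ _ := by gcongr

end LazyRevelation

end Equiv.Perm

/-! ### Expected number of cycles of a word value -/

namespace Equiv.Perm

section WordPaths

variable {α : Type*} {r : ℕ}

/-- The value of a letter after the substitution `x_i ↦ g_i`. -/
def letterPerm (g : Fin r → Perm α) (s : WordLetter (Perm α) r) : Perm α :=
  g s.var ^ (s.sign : ℤ) * s.const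

theorem wordValue_lettersVal (g : Fin r → Perm α) (N : List (WordLetter (Perm α) r)) :
    wordValue (lettersVal N) g = (N.map (letterPerm g)).prod := by
  simp only [wordValue, lettersVal, map_list_prod, List.map_map]
  congr 2
  ext s : 1
  simp [WordLetter.toCoprod, letterPerm]

theorem Hits.append {g : Fin r → Perm α} {p : α} {S : List (WordLetter (Perm α) r)}
    (S' : List (WordLetter (Perm α) r)) {q : α} (h : Hits g p S q) : Hits g p (S ++ S') q := by
  induction S generalizing q with
  | nil => exact h.elim
  | cons s S ih => exact h.imp id ih

theorem hits_of_prod_reverse {g : Fin r → Perm α} {p : α} {S : List (WordLetter (Perm α) r)}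
    (hS : S ≠ []) {q : α} (h : (S.reverse.map (letterPerm g)).prod q = p) : Hits g p S q := by
  induction S generalizing q with
  | nil => exact absurd rfl hS
  | cons s S ih =>
    simp only [List.reverse_cons, List.map_append, List.map_cons, List.map_nil, List.prod_append,
      List.prod_singleton, mul_apply] at h
    by_cases h0 : S = []
    · subst h0
      exact Or.inl h
    · exact Or.inr (ih h0 h)

/-- Products act from the right, so paths read `N` backwards; `k` rounds are a prefix of `K` rounds.
-/
theorem hits_of_pow_apply_eq {g : Fin r → Perm α} {p : α} {N : List (WordLetter (Perm α) r)}
    (hN : N ≠ []) {k K : ℕ} (hk : 0 < k) (hkK : k ≤ K)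
    (h : ((N.map (letterPerm g)).prod ^ k) p = p) :
    Hits g p (List.replicate K N.reverse).flatten p := by
  obtain ⟨m, rfl⟩ := Nat.exists_eq_add_of_le hkK
  rw [List.replicate_add, List.flatten_append]
  refine Hits.append _ (hits_of_prod_reverse ?_ ?_)
  · obtain ⟨j, rfl⟩ := Nat.exists_eq_succ_of_ne_zero hk.ne'
    simp [List.replicate_succ, hN]
  · simpa [List.reverse_flatten, List.map_flatten, List.prod_flatten] using h

theorem _root_.List.IsChain.flatten_replicate {β : Type*} {R : β → β → Prop} {N : List β}
    (h : (N ++ N).IsChain R) (k : ℕ) : (List.replicate k N).flatten.IsChain R := by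
  induction k with
  | zero => simp
  | succ k ih =>
    rw [List.isChain_append] at h
    rw [List.replicate_succ, List.flatten_cons, List.isChain_append]
    refine ⟨h.1, ih, fun x hx y hy => h.2.2 x hx y ?_⟩
    cases k with
    | zero => simp at hy
    | succ k =>
      cases N with
      | nil => simp at hx
      | cons a N => simpa [List.replicate_succ] using hy

-- Exchanging the sums over tuples and points turns the return probability into the expected number
-- of points of short period.
open Classical in
theorem sum_numCycles_le [Fintype α] [inst : DecidableEq α] [Nonempty α]
    {N : List (WordLetter (Perm α) r)} (hN : N ≠ [])
    (hchain : (N ++ N).IsChain (CriticalImp fun c : Perm α => ∀ x, c x ≠ x)) {K : ℕ}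
    (hK : 0 < K) :
    ∑ g : Fin r → Perm α, (numCycles (N.map (letterPerm g)).prod : ℝ) ≤
      (4 * ((K : ℝ) * N.length) ^ 2 + Fintype.card α / K) * Fintype.card (Fin r → Perm α) := by
  obtain rfl : inst = fun a b => Classical.propDecidable (a = b) := Subsingleton.elim _ _
  set S := (List.replicate K N.reverse).flatten with hS
  have hSlen : S.length = K * N.length := by simp [hS]
  have hS0 : S ≠ [] := by
    rw [← List.length_pos_iff, hSlen]
    exact Nat.mul_pos hK (List.length_pos_iff.2 hN)
  have hSc : S.IsChain (fun a b => CriticalImp (fun c : Perm α => ∀ x, c x ≠ x) b a) := by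
    refine List.IsChain.flatten_replicate ?_ K
    rw [← List.reverse_append]
    exact List.isChain_reverse.2 hchain
  have hn : (Fintype.card α : ℝ) ≠ 0 := by exact_mod_cast Fintype.card_ne_zero
  have hbad : ∑ g : Fin r → Perm α,
      (Nat.card {p : α // ∃ k, 0 < k ∧ k ≤ K ∧ ((N.map (letterPerm g)).prod ^ k) p = p} : ℝ) ≤
      4 * ((K : ℝ) * N.length) ^ 2 * Fintype.card (Fin r → Perm α) := by
    calc _ ≤ ∑ g : Fin r → Perm α, ((Finset.univ.filter fun p => Hits g p S p).card : ℝ) := by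
          refine Finset.sum_le_sum fun g _ => ?_
          rw [Nat.card_eq_fintype_card, Fintype.card_subtype]
          refine Nat.cast_le.2 (Finset.card_le_card fun p hp => ?_)
          obtain ⟨k, hk, hkK, hp⟩ := (Finset.mem_filter.1 hp).2
          exact Finset.mem_filter.2 ⟨Finset.mem_univ _, hits_of_pow_apply_eq hN hk hkK hp⟩
      _ = ∑ p : α, ((Finset.univ.filter fun g : Fin r → Perm α => Hits g p S p).card : ℝ) := by
          simp only [Finset.card_filter, Nat.cast_sum]
          exact Finset.sum_comm
      _ ≤ ∑ p : α, 4 * (S.length : ℝ) ^ 2 / Fintype.card α * Fintype.card (Fin r → Perm α) :=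
          Finset.sum_le_sum fun p _ => card_hits_self_le p S hS0 hSc
      _ = _ := by
          rw [Finset.sum_const, nsmul_eq_mul, Finset.card_univ, hSlen]
          push_cast
          field_simp
  calc _ ≤ ∑ g : Fin r → Perm α, ((Nat.card {p : α // ∃ k, 0 < k ∧ k ≤ K ∧
        ((N.map (letterPerm g)).prod ^ k) p = p} : ℝ) + Fintype.card α / K) :=
        Finset.sum_le_sum fun g _ => numCycles_le _ hK
    _ ≤ _ := by
        rw [Finset.sum_add_distrib, add_mul, Finset.sum_const, nsmul_eq_mul, Finset.card_univ]
        linarith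

theorem sum_numCycles_perm_le [Fintype α] [DecidableEq α] [Nonempty α] {K : ℕ} (hK : 0 < K) :
    ∑ h : Perm α, (numCycles h : ℝ) ≤
      (4 * (K : ℝ) ^ 2 + Fintype.card α / K) * Fintype.card (Perm α) := by
  have h := sum_numCycles_le (α := α) (r := 1) (N := [⟨0, 1, 1⟩]) (by simp)
    (by simp [CriticalImp]) hK
  rw [← (Equiv.funUnique (Fin 1) (Perm α)).sum_comp]
  simpa [letterPerm] using h

end WordPaths

end Equiv.Perm

/-! ### Uniform distributions and the coupling -/

namespace PMF

variable {A B : Type*} [Fintype A] [Nonempty A] [Fintype B] [Nonempty B]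

theorem uniformOfFintype_map_equiv (e : A ≃ B) :
    (uniformOfFintype A).map e = uniformOfFintype B := by
  classical
  ext b
  rw [map_apply, tsum_eq_single (e.symm b)]
  · simp [Fintype.card_congr e]
  · intro a ha
    rw [if_neg]
    rintro rfl
    simp at ha

theorem uniformOfFintype_prod :
    uniformOfFintype (A × B) =
      (uniformOfFintype A).bind fun a => (uniformOfFintype B).map (Prod.mk a) := by
  classical
  ext ⟨a, b⟩
  rw [bind_apply, tsum_eq_single a]
  · rw [map_apply, tsum_eq_single b]
    · simp only [uniformOfFintype_apply, if_true, Fintype.card_prod, Nat.cast_mul]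
      rw [ENNReal.mul_inv] <;> simp
    · intro b' hb'
      simp [hb'.symm]
  · intro a' ha'
    simp [map_apply, ha'.symm]

theorem uniformOfFintype_map_snd :
    (uniformOfFintype (A × B)).map Prod.snd = uniformOfFintype B := by
  rw [uniformOfFintype_prod, map_bind]
  simp only [map_comp]
  exact (bind_const _ _).trans (map_id _)

theorem uniformOfFintype_map_fst :
    (uniformOfFintype (A × B)).map Prod.fst = uniformOfFintype A := by
  rw [uniformOfFintype_prod, map_bind]
  simp only [map_comp]
  have : ∀ a : A, (Prod.fst ∘ Prod.mk a : B → A) = Function.const B a := fun _ => rfl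
  simp [this, map_const]

omit [Nonempty B] in
theorem sum_uniformOfFintype_map_toReal_mul (F : A → B) (φ : B → ℝ) :
    ∑ b, ((uniformOfFintype A).map F b).toReal * φ b = (∑ a, φ (F a)) / Fintype.card A := by
  classical
  have h : ∀ b, ((uniformOfFintype A).map F b).toReal =
      ∑ a, if b = F a then (Fintype.card A : ℝ)⁻¹ else 0 := by
    intro b
    rw [map_apply, tsum_fintype, ENNReal.toReal_sum]
    · refine Finset.sum_congr rfl fun a _ => ?_
      split_ifs <;> simp
    · intro a _
      split_ifs <;> simp
  simp only [h, Finset.sum_mul]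
  rw [Finset.sum_comm, Finset.sum_div]
  refine Finset.sum_congr rfl fun a _ => ?_
  simp [div_eq_inv_mul]

end PMF

open Equiv.Perm

theorem normalizedHamming_nonneg {n : ℕ} (σ τ : Equiv.Perm (Fin n)) :
    0 ≤ normalizedHamming σ τ := by
  unfold normalizedHamming
  positivity

/-- Conjugating both coordinates by the same uniform permutation couples `Σ(μ)` with the uniform
distribution. -/
theorem kantorovichRubinstein_conjSymmetrize_le {n : ℕ} {Ω : Type*} [Fintype Ω] [Nonempty Ω]
    (F : Ω → Equiv.Perm (Fin n)) (t : Ω → Equiv.Perm (Fin n) → Equiv.Perm (Fin n)) :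
    kantorovichRubinstein (conjSymmetrize ((PMF.uniformOfFintype Ω).map F))
        (PMF.uniformOfFintype (Equiv.Perm (Fin n))) ≤
      (∑ ω, ∑ h, normalizedHamming (F ω) (t ω h * h * (t ω h)⁻¹)) /
        (Fintype.card Ω * Fintype.card (Equiv.Perm (Fin n))) := by
  let X : Equiv.Perm (Fin n) × Ω × Equiv.Perm (Fin n) →
      Equiv.Perm (Fin n) × Equiv.Perm (Fin n) := fun x =>
    (x.1 * F x.2.1 * x.1⁻¹,
      x.1 * (t x.2.1 x.2.2 * x.2.2 * (t x.2.1 x.2.2)⁻¹) * x.1⁻¹)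
  refine csInf_le ⟨0, ?_⟩ ⟨(PMF.uniformOfFintype _).map X, ?_, ?_, ?_⟩
  · rintro _ ⟨γ, -, -, rfl⟩
    exact Finset.sum_nonneg fun p _ =>
      mul_nonneg ENNReal.toReal_nonneg (normalizedHamming_nonneg _ _)
  · rw [PMF.map_comp, PMF.uniformOfFintype_prod, PMF.map_bind, conjSymmetrize]
    congr 1
    ext1 σ
    rw [PMF.map_comp, PMF.map_comp, ← PMF.uniformOfFintype_map_fst (A := Ω)
      (B := Equiv.Perm (Fin n)), PMF.map_comp]
    rfl
  -- The conjugator `t` depends on `h`, but the second coordinate is still uniform: replacing `σ` by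
  -- `σ t` and `h` by its conjugate under `σ t` is a bijection, since the old `h`, and with it `t`,
  -- can be recovered.
  · let e : Equiv.Perm (Fin n) × Ω × Equiv.Perm (Fin n) ≃
        Equiv.Perm (Fin n) × Ω × Equiv.Perm (Fin n) :=
      { toFun := fun x => (x.1 * t x.2.1 x.2.2, x.2.1,
          (x.1 * t x.2.1 x.2.2) * x.2.2 * (x.1 * t x.2.1 x.2.2)⁻¹)
        invFun := fun x => (x.1 * (t x.2.1 (x.1⁻¹ * x.2.2 * x.1))⁻¹, x.2.1,
          x.1⁻¹ * x.2.2 * x.1)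
        left_inv := fun x => by simp [mul_assoc]
        right_inv := fun x => by simp [mul_assoc] }
    rw [PMF.map_comp]
    have hX : Prod.snd ∘ X = (Prod.snd ∘ Prod.snd) ∘ e := by
      ext1 x
      simp only [X, e, Function.comp_apply, Equiv.coe_fn_mk]
      group
    rw [hX, ← PMF.map_comp, PMF.uniformOfFintype_map_equiv, ← PMF.map_comp,
      PMF.uniformOfFintype_map_snd, PMF.uniformOfFintype_map_snd]
  · have hσ : ∀ σ f h : Equiv.Perm (Fin n),
        normalizedHamming (σ * f * σ⁻¹) (σ * h * σ⁻¹) = normalizedHamming f h := by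
      intro σ f h
      rw [normalizedHamming, hammingDist_conj, normalizedHamming]
    rw [PMF.sum_uniformOfFintype_map_toReal_mul X fun p => normalizedHamming p.1 p.2]
    simp only [X, hσ, Fintype.sum_prod_type, Fintype.card_prod, Finset.sum_const,
      Finset.card_univ, nsmul_eq_mul]
    push_cast
    rw [mul_div_mul_left]
    exact_mod_cast Fintype.card_ne_zero

/-! ### The final estimate -/

/-- The transport distance is controlled by the numbers of cycles. -/
theorem IsRegularWord.kantorovichRubinstein_le {n r : ℕ} (hn : 1 ≤ n)
    {w : Monoid.Coprod (Equiv.Perm (Fin n)) (FreeGroup (Fin r))} (hw : IsRegularWord w)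
    {W : ConstWord (Equiv.Perm (Fin n)) r} (hW : W.IsReduced) (hWw : W.toCoprod = w)
    {K : ℕ} (hK : 0 < K) :
    kantorovichRubinstein (conjSymmetrize (wordDistribution w))
        (PMF.uniformOfFintype (Equiv.Perm (Fin n))) ≤
      16 * (K : ℝ) ^ 2 * (W.length : ℝ) ^ 2 / n + 4 / K := by
  have : Nonempty (Fin n) := ⟨⟨0, hn⟩⟩
  obtain ⟨N, hN0, hNW, hNw, hchain⟩ := hw.exists_cyclic hW hWw
  let f₀ : (Fin r → Equiv.Perm (Fin n)) → Equiv.Perm (Fin n) := fun g =>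
    (N.map (letterPerm g)).prod
  have hconj : ∀ g, IsConj (f₀ g) (wordValue w g) := by
    intro g
    have := (Monoid.Coprod.lift (MonoidHom.id (Equiv.Perm (Fin n)))
      (FreeGroup.lift g)).map_isConj hNw
    rwa [← wordValue, ← wordValue, wordValue_lettersVal] at this
  choose t ht using fun g h => exists_conj_hammingDist_le (hconj g) h
  refine (kantorovichRubinstein_conjSymmetrize_le (wordValue w) t).trans ?_
  have hn' : (0 : ℝ) < n := by exact_mod_cast hn
  have hK' : (0 : ℝ) < K := by exact_mod_cast hK
  have hterm : ∀ g h, normalizedHamming (wordValue w g) (t g h * h * (t g h)⁻¹) ≤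
      2 / n * ((numCycles (f₀ g) : ℝ) + numCycles h) := by
    intro g h
    rw [normalizedHamming, div_mul_eq_mul_div]
    gcongr
    have := ht g h
    rw [mul_add]
    exact_mod_cast this
  have h1 := sum_numCycles_le hN0 hchain hK
  have h2 := sum_numCycles_perm_le (α := Fin n) hK
  rw [Fintype.card_fin] at h1 h2
  set a : ℝ := (Fintype.card (Fin r → Equiv.Perm (Fin n)) : ℝ) with ha
  set b : ℝ := (Fintype.card (Equiv.Perm (Fin n)) : ℝ) with hb
  have ha0 : 0 < a := by rw [ha]; exact_mod_cast Fintype.card_pos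
  have hb0 : 0 < b := by rw [hb]; exact_mod_cast Fintype.card_pos
  have hl : (N.length : ℝ) ≤ W.length := by exact_mod_cast hNW
  have hl1 : (1 : ℝ) ≤ N.length := by exact_mod_cast List.length_pos_iff.2 hN0
  rw [div_le_iff₀ (by positivity)]
  calc _ ≤ ∑ g, ∑ h : Equiv.Perm (Fin n),
        2 / (n : ℝ) * ((numCycles (f₀ g) : ℝ) + numCycles h) :=
        Finset.sum_le_sum fun g _ => Finset.sum_le_sum fun h _ => hterm g h
    _ = 2 / n * (b * (∑ g, (numCycles (f₀ g) : ℝ)) +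
          a * ∑ h : Equiv.Perm (Fin n), (numCycles h : ℝ)) := by
        simp only [← Finset.mul_sum, Finset.sum_add_distrib, Finset.sum_const, nsmul_eq_mul,
          Finset.card_univ, ← ha, ← hb]
    _ ≤ 2 / n * (b * ((4 * ((K : ℝ) * W.length) ^ 2 + n / K) * a) +
          a * ((4 * ((K : ℝ) * W.length) ^ 2 + n / K) * b)) := by
        have h1' : ∑ g, (numCycles (f₀ g) : ℝ) ≤
            (4 * ((K : ℝ) * W.length) ^ 2 + n / K) * a := h1.trans (by gcongr)
        have h2' : ∑ h : Equiv.Perm (Fin n), (numCycles h : ℝ) ≤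
            (4 * ((K : ℝ) * W.length) ^ 2 + n / K) * b := h2.trans (by
              gcongr
              exact le_mul_of_one_le_right hK'.le (hl1.trans hl))
        gcongr
    _ = _ := by
        field_simp
        ring

theorem theorem1p2 (ε : ℝ) (hε : 0 < ε) :
    ∃ C : ℝ, 0 < C ∧
      ∀ (n : ℕ), 1 ≤ n →
      ∀ (r : ℕ) (w : Monoid.Coprod (Equiv.Perm (Fin n)) (FreeGroup (Fin r))),
        IsRegularWord w →
        ∀ W : ConstWord (Equiv.Perm (Fin n)) r, W.IsReduced → W.toCoprod = w → 1 ≤ W.length →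
          kantorovichRubinstein (conjSymmetrize (wordDistribution w))
              (PMF.uniformOfFintype (Equiv.Perm (Fin n))) ≤
            C * (W.length : ℝ) ^ 2 * (n : ℝ) ^ (-(1 / 3 : ℝ) + ε) := by
  -- With `K = ⌈n^(1/3)⌉ ≤ 2 n^(1/3)` the constant is `16 * 4 + 4 = 68`, for every `ε`; the factor
  -- `n^ε` is only given away in the last inequality.
  refine ⟨68, by norm_num, fun n hn r w hw W hW hWw hl => ?_⟩
  have hn' : (1 : ℝ) ≤ n := by exact_mod_cast hn
  have hl' : (1 : ℝ) ≤ (W.length : ℝ) ^ 2 := one_le_pow₀ (by exact_mod_cast hl)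
  set x : ℝ := (n : ℝ) ^ (1 / 3 : ℝ) with hx
  have hx1 : 1 ≤ x := Real.one_le_rpow hn' (by norm_num)
  have hx3 : x ^ 3 = n := by
    rw [hx, ← Real.rpow_natCast, ← Real.rpow_mul (by positivity)]
    norm_num
  have hKx : x ≤ ⌈x⌉₊ := Nat.le_ceil x
  have hK2 : (⌈x⌉₊ : ℝ) ≤ 2 * x := by
    linarith [Nat.ceil_lt_add_one (zero_le_one.trans hx1)]
  have hK : 0 < ⌈x⌉₊ := Nat.ceil_pos.2 (by linarith)
  calc _ ≤ 16 * (⌈x⌉₊ : ℝ) ^ 2 * (W.length : ℝ) ^ 2 / n + 4 / ⌈x⌉₊ :=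
        hw.kantorovichRubinstein_le hn hW hWw hK
    _ ≤ 16 * (2 * x) ^ 2 * (W.length : ℝ) ^ 2 / x ^ 3 + 4 * (W.length : ℝ) ^ 2 / x := by
        rw [hx3]
        gcongr
        linarith
    _ = 68 * (W.length : ℝ) ^ 2 * x⁻¹ := by
        field_simp
        ring
    _ = 68 * (W.length : ℝ) ^ 2 * (n : ℝ) ^ (-(1 / 3 : ℝ)) := by
        rw [Real.rpow_neg (by positivity)]
    _ ≤ _ := by
        gcongr
        linarith
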